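/- Let $[n]=\{1,\dots,n\}$, let $q\ge 3$ be odd, and let $\mathcal H_1,\dots,\mathcal H_k$ be $q$-uniform matchings on $[n]$ (families of pairwise disjoint $q$-element subsets). Let $\mathcal H=\bigcup_{i\in[k]}\mathcal H_i$ be their union as a multi-hypergraph (a set lying in several $\mathcal H_i$ gives that many parallel hyperedges, and hyperedges are counted with multiplicity). For $1\le r\le q$ let $d_r$ be the maximum, over $r$-element sets $Q\subseteq[n]$, of the number of hyperedges of $\mathcal H$ containing $Q$. Let $1\le t\le q$ and suppose that $\mathcal H$ is $t$-approximately strongly regular with partition $\mathcal H=\mathcal H_1^{(t)}\sqcup\dots\sqcup\mathcal H_{p}^{(t)}$ and sets $Q_1,\dots,Q_p\in\binom{[n]}{t}$, that is: 1. all $C\in\mathcal H^{(t)}_\theta$ contain $Q_\theta$, for every $\theta\in[p]$; 2. $d_t/2\le|\mathcal H^{(t)}_\theta|\le d_t$ for every $\theta\in[p]$; 3. $t$ is a good index for $d_1\ge\dots\ge d_q$, meaning (a) $d_r\le n^{1-2r/q}\,d_t$ for all $1\le r\le\lceil\frac{q-t}{2}\rceil$; (b) $d_r\le n^{-\frac2q(r-t)+\frac1q(t-\mathbf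 1(t\text{ even}))}\,d_t$ for all $t\le r\le\lfloor\frac{q+t}{2}\rfloor$; (c) if $t<q/2$ then $d_t\ge d_1n^{-2(t-1)/q}$, and if $t>q/2$ then $d_t\ge d_1n^{-1+2/q}$. Let the integer $\ell$ be $n^{1-2/q}\log n$ rounded up or down, and suppose that $k\ge d_1\ge\ell$. The level-$\ell$ Kikuchi graph has vertex set $\binom{[n]\times[2]}{\ell}$. For distinct hyperedges $C,C'\in\mathcal H^{(t)}_\theta$ put $X=(C\setminus Q_\theta)\times\{1\}$ and $Y=(C'\setminus Q_\theta)\times\{2\}$, and write $S\overset{C,C'}{\longleftrightarrow}T$ if the symmetric differences satisfy $S\oplus T=X\oplus Y$ and either $|S\cap X|=|T\cap Y|=\lceil\frac{q-t}2\rceil$ and $|S\cap Y|=|T\cap X|=\lfloor\frac{q-t}2\rfloor$, or the same holds with $\lceil\cdot\rceil$ and $\lfloor\cdot\rfloor$ exchanged. Let $\overline K^{(C,C')}$ be the $0/1$ matrix of this relation. For a partition $L\sqcup R=[k]$, signs $b\in\{\pm1\}^k$ and $i\in L$ let $$K_{i,t}=\sum_{j\in R}b_j\sum_{\theta\in[p]}\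 \sum_{C\in\mathcal H_i\cap\mathcal H^{(t)}_\theta,\ C'\in\mathcal H_j\cap\mathcal H^{(t)}_\theta}\overline K^{(C,C')},$$ and let $\deg_{K_{i,t}}(S)$ be the maximum over $b$ of the $\ell_1$ norm of row $S$ of $K_{i,t}$. Then $d_t\ge d_1n^{-2(t-1)/q}$ if $t<q/2$, and $d_t\ge d_1n^{-1+2/q}$ if $t>q/2$. Moreover, there is an absolute constant $W\ge1$ (independent of all the data above, including $q$) such that, for every partition $L\sqcup R=[k]$ and every $i\in L$, all but an $n^{-100q}$ fraction of the vertices $S\in\binom{[n]\times[2]}{\ell}$ satisfy $$\deg_{K_{i,t}}(S)\le\left(\frac{\ell}{n}\right)^{q-t}n\,d_t\,W^q .$$ -/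

import Mathlib

/-- A finite family `M` of subsets of `[n]` is a `q`-uniform (hypergraph) matching: every member
has exactly `q` elements, and distinct members are disjoint. -/
def IsUniformMatching {n : ℕ} (q : ℕ) (M : Finset (Finset (Fin n))) : Prop :=
  (∀ C ∈ M, C.card = q) ∧ ∀ C ∈ M, ∀ C' ∈ M, C ≠ C' → Disjoint C C'

/-- Hyperedges of the union `H = H_1 ∪ ⋯ ∪ H_k`, which is a multi-hypergraph: a set that lies in
several of the `H i` gives parallel hyperedges, one for each such `i`. -/
abbrev UnionEdge {n k : ℕ} (H : Fin k → Finset (Finset (Fin n))) : Type :=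
  (i : Fin k) × {C : Finset (Fin n) // C ∈ H i}

/-- The set of vertices of a hyperedge of the union. -/
def unionSupp {n k : ℕ} (H : Fin k → Finset (Finset (Fin n))) (e : UnionEdge H) :
    Finset (Fin n) :=
  e.2.1

/-- The co-degree of `Q` in the multi-hypergraph on `[n]` with hyperedges `supp e`, `e : E`:
the number of hyperedges (with multiplicity) that contain `Q`. -/
def codegree {n : ℕ} {E : Type} [Fintype E] (supp : E → Finset (Fin n)) (Q : Finset (Fin n)) : ℕ :=
  (Finset.univ.filter fun e : E => Q ⊆ supp e).card

/-- `d_r`: the maximum co-degree of a set of `r` vertices. -/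
def maxCodegree {n : ℕ} {E : Type} [Fintype E] (supp : E → Finset (Fin n)) (r : ℕ) : ℕ :=
  (Finset.powersetCard r Finset.univ).sup (codegree supp)

/-- `t` is a good index for the sequence `d_1 ≥ ⋯ ≥ d_q` (on a ground set of size `n`). The bounds
on the quotients `d_r / d_t` are written without division. For `t ≤ q` the natural number
`(q - t + 1) / 2` is `⌈(q - t) / 2⌉` and `(q + t) / 2` is `⌊(q + t) / 2⌋`. -/
structure IsGoodIndex (n q t : ℕ) (d : ℕ → ℕ) : Prop where
  small : ∀ r : ℕ, 1 ≤ r → r ≤ (q - t + 1) / 2 →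
    (d r : ℝ) ≤ (n : ℝ) ^ (1 - 2 * (r : ℝ) / q) * d t
  large : ∀ r : ℕ, t ≤ r → r ≤ (q + t) / 2 →
    (d r : ℝ) ≤ (n : ℝ) ^ (-(2 / (q : ℝ)) * ((r : ℝ) - t)
      + 1 / (q : ℝ) * ((t : ℝ) - if Even t then 1 else 0)) * d t
  lower_left : 2 * t < q → (d 1 : ℝ) * (n : ℝ) ^ (-(2 / (q : ℝ)) * ((t : ℝ) - 1)) ≤ d t
  lower_right : q < 2 * t → (d 1 : ℝ) * (n : ℝ) ^ (-1 + 2 / (q : ℝ)) ≤ d t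

/-- The map `part : E → Fin p`, together with the sets `Q θ`, is a partition of the hyperedges that
witnesses the `t`-approximate strong regularity of a `q`-uniform multi-hypergraph. The piece
`H_θ` consists of the hyperedges `e` with `part e = θ`. -/
structure IsStrongRegularPartition {n : ℕ} {E : Type} [Fintype E] (q t : ℕ)
    (supp : E → Finset (Fin n)) {p : ℕ} (part : E → Fin p) (Q : Fin p → Finset (Fin n)) :
    Prop where
  uniform : ∀ e, (supp e).card = q
  one_le : 1 ≤ t
  le : t ≤ q
  card_Q : ∀ θ, (Q θ).card = t
  subset : ∀ e, Q (part e) ⊆ supp e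
  half_le : ∀ θ, (maxCodegree supp t : ℝ) / 2 ≤ (Finset.univ.filter fun e => part e = θ).card
  card_le : ∀ θ, (Finset.univ.filter fun e => part e = θ).card ≤ maxCodegree supp t
  good : IsGoodIndex n q t (maxCodegree supp)

/-- Vertices of the level-`ℓ` Kikuchi graph: the `ℓ`-element subsets of `[n] × [2]`. -/
abbrev KikuchiVertex (n ℓ : ℕ) : Type := {S : Finset (Fin n × Fin 2) // S.card = ℓ}

/-- The relation `S ↔ T` induced by `A = C \ Q_θ` and `A' = C' \ Q_θ`, with `m = q - t`. Here
`X = A × {1}` and `Y = A' × {2}` (the two copies are numbered `0` and `1`). -/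
def KikuchiAdj {n : ℕ} (m : ℕ) (A A' : Finset (Fin n)) (S T : Finset (Fin n × Fin 2)) : Prop :=
  let X : Finset (Fin n × Fin 2) := A ×ˢ {0}
  let Y : Finset (Fin n × Fin 2) := A' ×ˢ {1}
  symmDiff S T = symmDiff X Y ∧
  (Even m → (S ∩ X).card = m / 2 ∧ (S ∩ Y).card = m / 2 ∧
    (T ∩ X).card = m / 2 ∧ (T ∩ Y).card = m / 2) ∧
  (Odd m →
    ((S ∩ X).card = (m + 1) / 2 ∧ (T ∩ Y).card = (m + 1) / 2 ∧
      (S ∩ Y).card = m / 2 ∧ (T ∩ X).card = m / 2) ∨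
    ((S ∩ X).card = m / 2 ∧ (T ∩ Y).card = m / 2 ∧
      (S ∩ Y).card = (m + 1) / 2 ∧ (T ∩ X).card = (m + 1) / 2))

open Classical in
/-- The 0/1 matrix of the relation induced by one pair of hyperedges. -/
noncomputable def kikuchiPairMatrix {n : ℕ} (m ℓ : ℕ) (A A' : Finset (Fin n)) :
    Matrix (KikuchiVertex n ℓ) (KikuchiVertex n ℓ) ℝ :=
  fun S T => if KikuchiAdj m A A' S.1 T.1 then 1 else 0

/-- The unsigned Kikuchi matrix of the pair of matchings `H i`, `H j`, with `m = q - t`: the sum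
over `θ` and over `C ∈ H_i ∩ H_θ`, `C' ∈ H_j ∩ H_θ` of the matrices of the pairs `(C, C')`. -/
noncomputable def kikuchiUnsigned {n k p : ℕ} (m ℓ : ℕ) (H : Fin k → Finset (Finset (Fin n)))
    (part : UnionEdge H → Fin p) (Q : Fin p → Finset (Fin n)) (i j : Fin k) :
    Matrix (KikuchiVertex n ℓ) (KikuchiVertex n ℓ) ℝ :=
  ∑ θ : Fin p,
    ∑ e ∈ Finset.univ.filter (fun e : UnionEdge H => e.1 = i ∧ part e = θ),
      ∑ e' ∈ Finset.univ.filter (fun e' : UnionEdge H => e'.1 = j ∧ part e' = θ),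
        kikuchiPairMatrix m ℓ (unionSupp H e \ Q θ) (unionSupp H e' \ Q θ)

/-- The signed Kikuchi matrix `K_i = ∑_{j ∈ R} b_j K̄_{i,j}` for signs `b : [k] → {1, -1}`. -/
noncomputable def kikuchiSigned {n k p : ℕ} (m ℓ : ℕ) (H : Fin k → Finset (Finset (Fin n)))
    (part : UnionEdge H → Fin p) (Q : Fin p → Finset (Fin n)) (R : Finset (Fin k))
    (b : Fin k → ℤˣ) (i : Fin k) : Matrix (KikuchiVertex n ℓ) (KikuchiVertex n ℓ) ℝ :=
  ∑ j ∈ R, (((b j : ℤˣ) : ℤ) : ℝ) • kikuchiUnsigned m ℓ H part Q i j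

/-- The degree of `S` in `K_i`: the maximum, over all choices of signs, of the `ℓ₁` norm of the row
of the signed matrix indexed by `S`. -/
noncomputable def kikuchiDegree {n k p : ℕ} (m ℓ : ℕ) (H : Fin k → Finset (Finset (Fin n)))
    (part : UnionEdge H → Fin p) (Q : Fin p → Finset (Fin n)) (R : Finset (Fin k))
    (i : Fin k) (S : KikuchiVertex n ℓ) : ℝ :=
  ⨆ b : Fin k → ℤˣ, ∑ T : KikuchiVertex n ℓ, |kikuchiSigned m ℓ H part Q R b i S T|

open Finset

/-! The lower bounds on `d_t` are clauses of the definition of a good index; the content is the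
degree bound, proved by the moment method. Put `m = q - t`. A nonzero entry of row `S` for a pair
`(C, C')` forces `S` to contain a balanced `m`-subset of `X ∪ Y`, so the degree is at most the
number `f(S)` of such monomials (pair plus balanced subset) inside `S` (`kikuchiDegree_le`).

Matching disjointness and the good-index inequalities show that at most `4^m n^(1-2r/q) d_t`
monomials contain a fixed `r`-set (`card_kikuchiMonomials_above_le`). Expanding the `s`-th moment of
`f` for a uniform `S` one monomial at a time, each new monomial meets the at most `sm` elements
already exposed in some `r`-set. With `s` of order `log n`, the choice of overlap costs `C(sm, r)`,
and `n^(-2/q) log n ≤ 2ℓ/n` turns the sum over `r` into an exponential series. So each step costs at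
most a factor `C^q (ℓ/n)^m n d_t` with `C` absolute, and Markov's inequality with `s = ⌈log n⌉`
gives the tail `n^(-100q)`. -/

/-! ### Moments of containment counts in a random `ℓ`-subset. -/

theorem choose_sub_mul_pow_le {N ℓ : ℕ} (h : ℓ ≤ N) :
    ∀ a ≤ ℓ, (N - a).choose (ℓ - a) * N ^ a ≤ ℓ ^ a * N.choose ℓ
  | 0, _ => by simp
  | a + 1, ha => by
    have ih := choose_sub_mul_pow_le h a (by omega)
    obtain ⟨x, rfl⟩ : ∃ x, ℓ = x + 1 + a := ⟨ℓ - a - 1, by omega⟩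
    obtain ⟨y, rfl⟩ : ∃ y, N = y + 1 + a := ⟨N - a - 1, by omega⟩
    rw [Nat.add_sub_cancel, Nat.add_sub_cancel] at ih
    have e1 : y + 1 + a - (a + 1) = y := by omega
    have e2 : x + 1 + a - (a + 1) = x := by omega
    rw [e1, e2]
    have key := Nat.add_one_mul_choose_eq y x
    -- Each successive ratio `(ℓ - a) / (N - a)` is at most `ℓ / N`.
    have h2 : (x + 1) * (y + 1 + a) ≤ (x + 1 + a) * (y + 1) := by nlinarith
    refine Nat.le_of_mul_le_mul_left ?_ (show 0 < y + 1 by omega)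
    calc (y + 1) * (y.choose x * (y + 1 + a) ^ (a + 1))
        = ((y + 1) * y.choose x) * (y + 1 + a) ^ a * (y + 1 + a) := by ring
      _ = ((y + 1).choose (x + 1) * (y + 1 + a) ^ a) * ((x + 1) * (y + 1 + a)) := by
          rw [key]; ring
      _ ≤ ((x + 1 + a) ^ a * (y + 1 + a).choose (x + 1 + a)) * ((x + 1 + a) * (y + 1)) :=
          Nat.mul_le_mul ih h2
      _ = _ := by ring

/-- Each `i` is charged to its overlap `A = U ∩ M i`. Relaxing this to all `A ⊆ U` with `A ⊆ M i`
only adds nonnegative terms; the sum then splits by `|A|`. -/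
theorem sum_pow_sub_card_inter_le {α ι : Type*} [DecidableEq α] (I : Finset ι) (M : ι → Finset α) (m K : ℕ)
    (hM : ∀ i ∈ I, (M i).card = m) (p : ℝ) (hp : 0 ≤ p) (μ : ℕ → ℝ) (hμ0 : ∀ r, 0 ≤ μ r)
    (hμ : ∀ A : Finset α, A.card ≤ m →
      ((I.filter fun i => A ⊆ M i).card : ℝ) * p ^ (m - A.card) ≤ μ A.card)
    (U : Finset α) (hU : U.card ≤ K) :
    ∑ i ∈ I, p ^ (m - (U ∩ M i).card) ≤ ∑ r ∈ range (m + 1), (K.choose r : ℝ) * μ r := by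
  calc ∑ i ∈ I, p ^ (m - (U ∩ M i).card)
      ≤ ∑ i ∈ I, ∑ A ∈ U.powerset.filter (fun A => A.card ≤ m),
          if A ⊆ M i then p ^ (m - A.card) else 0 := by
        refine sum_le_sum fun i hi => ?_
        have := single_le_sum (f := fun A : Finset α =>
          if A ⊆ M i then p ^ (m - A.card) else 0) (s := U.powerset.filter (fun A => A.card ≤ m))
          (fun A _ => by positivity) (a := U ∩ M i)
          (by
            rw [mem_filter, mem_powerset, ← hM i hi]
            exact ⟨inter_subset_left, card_le_card inter_subset_right⟩)
        simpa [inter_subset_right] using this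
    _ = ∑ A ∈ U.powerset.filter (fun A => A.card ≤ m),
          ((I.filter fun i => A ⊆ M i).card : ℝ) * p ^ (m - A.card) := by
        rw [sum_comm]
        refine sum_congr rfl fun A _ => ?_
        rw [← sum_filter, sum_const, nsmul_eq_mul]
    _ ≤ ∑ A ∈ U.powerset.filter (fun A => A.card ≤ m), μ A.card :=
        sum_le_sum fun A hA => hμ A (mem_filter.1 hA).2
    _ = ∑ r ∈ range (m + 1), ∑ A ∈ U.powerset.filter (fun A => A.card ≤ m) with A.card = r,
          μ A.card := by
        refine (sum_fiberwise_of_maps_to (fun A hA => ?_) _).symm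
        have := (mem_filter.1 hA).2
        rw [mem_range]; omega
    _ ≤ ∑ r ∈ range (m + 1), (K.choose r : ℝ) * μ r := by
        refine sum_le_sum fun r _ => ?_
        rw [sum_congr rfl fun A hA => congrArg μ (mem_filter.1 hA).2, sum_const, nsmul_eq_mul]
        refine mul_le_mul_of_nonneg_right ?_ (hμ0 r)
        have : ({A ∈ U.powerset.filter (fun A => A.card ≤ m) | A.card = r}).card
            ≤ (powersetCard r U).card := by
          refine card_le_card fun A hA => ?_
          simp only [mem_filter, mem_powerset] at hA
          exact mem_powersetCard.2 ⟨hA.1.1, hA.2⟩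
        rw [card_powersetCard] at this
        exact_mod_cast this.trans (Nat.choose_le_choose r hU)

section
variable {α : Type*} [Fintype α]

theorem card_subtype_card_eq (ℓ : ℕ) :
    Fintype.card {S : Finset α // S.card = ℓ} = (Fintype.card α).choose ℓ := by
  rw [Fintype.card_subtype, ← card_univ, ← card_powersetCard]
  congr 1
  ext S
  simp [mem_powersetCard]

variable [DecidableEq α]

theorem card_filter_superset_le (ℓ : ℕ) (U : Finset α) :
    (univ.filter fun S : {S : Finset α // S.card = ℓ} => U ⊆ S.1).card
      ≤ (Fintype.card α - U.card).choose (ℓ - U.card) := by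
  rw [← card_compl, ← card_powersetCard]
  refine card_le_card_of_injOn (fun S => S.1 \ U) ?_ ?_
  · intro S hS
    simp only [coe_filter, mem_univ, true_and, Set.mem_ofPred_eq] at hS
    simp only [mem_coe, mem_powersetCard]
    refine ⟨fun x hx => ?_, ?_⟩
    · simp only [mem_sdiff] at hx
      simpa using hx.2
    · rw [card_sdiff_of_subset hS, S.2]
  · intro S hS T hT hST
    simp only [coe_filter, mem_univ, true_and, Set.mem_ofPred_eq] at hS hT
    apply Subtype.ext
    rw [← sdiff_union_of_subset hS, ← sdiff_union_of_subset hT]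
    exact congrArg (· ∪ U) hST

/-- A uniformly random `ℓ`-subset contains a given set `U` with probability at most
`(ℓ / |α|) ^ |U|`. -/
theorem card_filter_superset_le_mul_pow (ℓ : ℕ) (U : Finset α) :
    ((univ.filter fun S : {S : Finset α // S.card = ℓ} => U ⊆ S.1).card : ℝ)
      ≤ Fintype.card {S : Finset α // S.card = ℓ} * ((ℓ : ℝ) / Fintype.card α) ^ U.card := by
  rcases (univ.filter fun S : {S : Finset α // S.card = ℓ} => U ⊆ S.1).eq_empty_or_nonempty with
    h | ⟨S, hS⟩
  · rw [h]
    simp only [card_empty, Nat.cast_zero]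
    positivity
  have hUS : U ⊆ S.1 := (mem_filter.1 hS).2
  have h1 : U.card ≤ ℓ := by simpa [S.2] using card_le_card hUS
  have h2 : ℓ ≤ Fintype.card α := by simpa [S.2] using card_le_univ S.1
  rcases Nat.eq_zero_or_pos (Fintype.card α) with h0 | h0
  · have hU : U.card = 0 := by omega
    rw [hU, pow_zero, mul_one]
    exact_mod_cast card_le_univ _
  have h3 := choose_sub_mul_pow_le h2 U.card h1
  have h4 := Nat.mul_le_mul_right (Fintype.card α ^ U.card) (card_filter_superset_le ℓ U)
  have h5 := h4.trans h3
  rw [card_subtype_card_eq, div_pow, ← mul_div_assoc, le_div_iff₀ (by positivity), mul_comm (Nat.cast _ : ℝ) ((ℓ : ℝ) ^ _)]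
  exact_mod_cast h5

/-- Moment bound for the number of members of a family `M` of `m`-sets that lie inside a random
`ℓ`-subset, restricted to the event that the subset contains `U`. -/
theorem sum_pow_card_filter_subset_le {ι : Type*} (I : Finset ι) (M : ι → Finset α) (m ℓ K : ℕ)
    (hM : ∀ i ∈ I, (M i).card = m) (μ : ℕ → ℝ) (hμ0 : ∀ r, 0 ≤ μ r)
    (hμ : ∀ A : Finset α, A.card ≤ m → ((I.filter fun i => A ⊆ M i).card : ℝ) *
      ((ℓ : ℝ) / Fintype.card α) ^ (m - A.card) ≤ μ A.card) :
    ∀ (s : ℕ) (U : Finset α), U.card + s * m ≤ K →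
    ∑ S : {S : Finset α // S.card = ℓ} with U ⊆ S.1,
        ((I.filter fun i => M i ⊆ S.1).card : ℝ) ^ s
      ≤ Fintype.card {S : Finset α // S.card = ℓ} * ((ℓ : ℝ) / Fintype.card α) ^ U.card *
        (∑ r ∈ range (m + 1), (K.choose r : ℝ) * μ r) ^ s
  | 0, U, _ => by
    simpa using card_filter_superset_le_mul_pow ℓ U
  | s + 1, U, hU => by
    set p : ℝ := (ℓ : ℝ) / Fintype.card α with hp
    have hp0 : 0 ≤ p := by positivity
    set B : ℝ := ∑ r ∈ range (m + 1), (K.choose r : ℝ) * μ r with hB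
    have hB0 : 0 ≤ B := sum_nonneg fun r _ => mul_nonneg (by positivity) (hμ0 r)
    have hsm : (s + 1) * m = s * m + m := by ring
    -- One factor of the power is expanded: requiring `M i ⊆ S` replaces `U` by `U ∪ M i`, which
    -- spends `m` of the budget `K`.
    calc ∑ S : {S : Finset α // S.card = ℓ} with U ⊆ S.1,
          ((I.filter fun i => M i ⊆ S.1).card : ℝ) ^ (s + 1)
        = ∑ i ∈ I, ∑ S : {S : Finset α // S.card = ℓ} with U ∪ M i ⊆ S.1,
            ((I.filter fun i => M i ⊆ S.1).card : ℝ) ^ s := by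
          simp only [sum_filter]
          rw [sum_comm]
          refine sum_congr rfl fun S _ => ?_
          by_cases h : U ⊆ S.1
          · simp only [h, if_true, union_subset_iff, true_and]
            rw [← sum_filter, sum_const, nsmul_eq_mul, pow_succ, mul_comm]
          · simp [h, union_subset_iff]
      _ ≤ ∑ i ∈ I, Fintype.card {S : Finset α // S.card = ℓ} * p ^ (U ∪ M i).card * B ^ s := by
          refine sum_le_sum fun i hi => ?_
          refine sum_pow_card_filter_subset_le I M m ℓ K hM μ hμ0 hμ s (U ∪ M i) ?_
          have h1 := card_union_le U (M i)
          rw [hM i hi] at h1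
          omega
      _ = Fintype.card {S : Finset α // S.card = ℓ} * p ^ U.card * B ^ s *
            ∑ i ∈ I, p ^ (m - (U ∩ M i).card) := by
          rw [mul_sum]
          refine sum_congr rfl fun i hi => ?_
          have h1 := card_union_add_card_inter U (M i)
          have h2 : (U ∩ M i).card ≤ (M i).card := card_le_card inter_subset_right
          rw [hM i hi] at h1 h2
          have h3 : (U ∪ M i).card = U.card + (m - (U ∩ M i).card) := by omega
          rw [h3, pow_add]
          ring
      _ ≤ Fintype.card {S : Finset α // S.card = ℓ} * p ^ U.card * B ^ s * B := by
          refine mul_le_mul_of_nonneg_left ?_ (by positivity)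
          exact sum_pow_sub_card_inter_le I M m K hM p hp0 μ hμ0 hμ U (by omega)
      _ = _ := by rw [pow_succ]; ring
end

/-! ### Co-degrees. -/

section
variable {n : ℕ} {E : Type} [Fintype E] (supp : E → Finset (Fin n))

theorem codegree_le_maxCodegree (A : Finset (Fin n)) :
    codegree supp A ≤ maxCodegree supp A.card :=
  le_sup (f := codegree supp) (mem_powersetCard.2 ⟨subset_univ _, rfl⟩)

theorem maxCodegree_antitone {r s : ℕ} (h : r ≤ s) : maxCodegree supp s ≤ maxCodegree supp r := by
  refine Finset.sup_le fun A hA => ?_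
  have hA' := (mem_powersetCard.1 hA).2
  obtain ⟨B, hBA, hB⟩ := exists_subset_card_eq (h.trans hA'.ge)
  have h1 := codegree_le_maxCodegree supp B
  rw [hB] at h1
  refine le_trans (card_le_card fun e he => ?_) h1
  simp only [mem_filter, mem_univ, true_and] at he ⊢
  exact hBA.trans he

end

/-! ### Counting pairs of hyperedges in a common part. -/

section
variable {n k : ℕ} {H : Fin k → Finset (Finset (Fin n))}

theorem unionEdge_eq_of_mem {q : ℕ} {i : Fin k} (hH : IsUniformMatching q (H i))
    {e f : UnionEdge H} (he : e.1 = i) (hf : f.1 = i) {x : Fin n}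
    (hxe : x ∈ unionSupp H e) (hxf : x ∈ unionSupp H f) : e = f := by
  obtain ⟨a, C, hC⟩ := e
  obtain ⟨b, D, hD⟩ := f
  obtain rfl : a = i := he
  obtain rfl : b = a := hf
  have : C = D := by
    by_contra hne
    exact disjoint_left.1 (hH.2 C hC D hD hne) hxe hxf
  subst this
  rfl

theorem card_unionEdge_index_le {q : ℕ} (hq : 0 < q) {i : Fin k}
    (hH : IsUniformMatching q (H i)) :
    (univ.filter fun e : UnionEdge H => e.1 = i).card ≤ n := by
  have hne : ∀ e : UnionEdge H, e.1 = i → ∃ x, x ∈ unionSupp H e := by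
    rintro ⟨a, C, hC⟩ rfl
    exact card_pos.1 (by rw [unionSupp, hH.1 C hC]; exact hq)
  choose g hg using hne
  rw [← card_attach]
  refine le_trans (card_le_card_of_injOn (t := univ) (fun e => g e.1 (mem_filter.1 e.2).2) (by simp) ?_)
    (card_univ.trans (Fintype.card_fin n)).le
  rintro ⟨e, he⟩ - ⟨f, hf⟩ - h
  have he' := (mem_filter.1 he).2
  have hf' := (mem_filter.1 hf).2
  refine Subtype.ext (unionEdge_eq_of_mem hH he' hf' (hg e he') ?_)
  have h' : g e he' = g f hf' := h
  rw [h']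
  exact hg f hf'

/-- The pairs of hyperedges in a common part, the first one in `H i`. -/
def edgePairs {p : ℕ} (part : UnionEdge H → Fin p) (i : Fin k) :
    Finset (UnionEdge H × UnionEdge H) :=
  univ.filter fun x => x.1.1 = i ∧ part x.1 = part x.2

/-- The pairs whose sides outside of the common `t`-set contain `A` and `A'`, respectively. -/
def edgePairsAbove {p : ℕ} (part : UnionEdge H → Fin p) (Q : Fin p → Finset (Fin n)) (i : Fin k)
    (A A' : Finset (Fin n)) : Finset (UnionEdge H × UnionEdge H) :=
  (edgePairs part i).filter fun x =>
    A ⊆ unionSupp H x.1 \ Q (part x.1) ∧ A' ⊆ unionSupp H x.2 \ Q (part x.2)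

variable {p q t : ℕ} {part : UnionEdge H → Fin p} {Q : Fin p → Finset (Fin n)} {i : Fin k}
  {A A' : Finset (Fin n)}

/-- A matching offers at most `n` choices of first edge, and a part at most `d_t` choices of second
edge. -/
theorem card_edgePairsAbove_le_mul (hq : 0 < q) (hH : IsUniformMatching q (H i))
    (hP : IsStrongRegularPartition q t (unionSupp H) part Q) :
    (edgePairsAbove part Q i A A').card ≤ n * maxCodegree (unionSupp H) t := by
  rw [mul_comm]
  refine (card_le_mul_card_image_of_maps_to
    (t := univ.filter fun e : UnionEdge H => e.1 = i) (f := Prod.fst) ?_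
    (maxCodegree (unionSupp H) t) ?_).trans
    (Nat.mul_le_mul_left _ (card_unionEdge_index_le hq hH))
  · intro x hx
    simp only [edgePairsAbove, edgePairs, mem_filter, mem_univ, true_and] at hx ⊢
    exact hx.1.1
  · intro e _
    refine le_trans (card_le_card_of_injOn Prod.snd ?_ ?_) (hP.card_le (part e))
    · rintro ⟨x, y⟩ hx
      simp only [edgePairsAbove, edgePairs, coe_filter, mem_filter, mem_univ, true_and,
        Set.mem_ofPred_eq] at hx ⊢
      obtain ⟨⟨⟨-, h⟩, -⟩, rfl⟩ := hx
      exact h.symm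
    · rintro ⟨x, y⟩ hx ⟨x', y'⟩ hx' h
      simp only [coe_filter, Set.mem_ofPred_eq] at hx hx'
      exact Prod.ext (hx.2.trans hx'.2.symm) h

/-- A vertex of `A` determines the first edge in the matching, hence `θ`; the second edge then
contains the disjoint union `Q θ ∪ A'`. -/
theorem card_edgePairsAbove_le_of_nonempty_left (hH : IsUniformMatching q (H i))
    (hP : IsStrongRegularPartition q t (unionSupp H) part Q) (hA : A.Nonempty) :
    (edgePairsAbove part Q i A A').card ≤ maxCodegree (unionSupp H) (t + A'.card) := by
  rcases (edgePairsAbove part Q i A A').eq_empty_or_nonempty with h0 | ⟨⟨e, e'⟩, he⟩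
  · simp [h0]
  obtain ⟨x, hx⟩ := hA
  simp only [edgePairsAbove, edgePairs, mem_filter, mem_univ, true_and] at he
  obtain ⟨⟨hei, hee'⟩, hAe, hA'e⟩ := he
  have hdisj : Disjoint (Q (part e)) A' := by
    rw [hee']
    exact (disjoint_sdiff (s := Q (part e'))).mono_right hA'e
  have h1 := codegree_le_maxCodegree (unionSupp H) (Q (part e) ∪ A')
  rw [card_union_of_disjoint hdisj, hP.card_Q] at h1
  have huniq : ∀ y ∈ edgePairsAbove part Q i A A', y.1 = e := by
    intro y hy
    simp only [edgePairsAbove, edgePairs, mem_filter, mem_univ, true_and] at hy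
    exact unionEdge_eq_of_mem hH hy.1.1 hei (mem_sdiff.1 (hy.2.1 hx)).1 (mem_sdiff.1 (hAe hx)).1
  refine le_trans (card_le_card_of_injOn Prod.snd ?_ ?_) h1
  · intro y hy
    have hye := huniq y hy
    simp only [edgePairsAbove, edgePairs, coe_filter, mem_filter, mem_univ, true_and,
      Set.mem_ofPred_eq] at hy ⊢
    rw [← hye, hy.1.2]
    exact union_subset (hP.subset _) (hy.2.2.trans sdiff_subset)
  · intro y hy z hz h
    exact Prod.ext ((huniq y hy).trans (huniq z hz).symm) h

/-- The second edge determines `θ`. Since `t ≥ 1`, a vertex of `Q θ` then determines the first edge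
in the matching. -/
theorem card_edgePairsAbove_le_maxCodegree_right (hH : IsUniformMatching q (H i))
    (hP : IsStrongRegularPartition q t (unionSupp H) part Q) :
    (edgePairsAbove part Q i A A').card ≤ maxCodegree (unionSupp H) A'.card := by
  refine le_trans (card_le_card_of_injOn Prod.snd ?_ ?_)
    (codegree_le_maxCodegree (unionSupp H) A')
  · intro y hy
    simp only [edgePairsAbove, edgePairs, coe_filter, mem_filter, mem_univ, true_and,
      Set.mem_ofPred_eq] at hy ⊢
    exact hy.2.2.trans sdiff_subset
  · rintro ⟨e, f⟩ hy ⟨e', f'⟩ hz h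
    obtain rfl : f = f' := h
    simp only [edgePairsAbove, edgePairs, coe_filter, mem_filter, mem_univ, true_and,
      Set.mem_ofPred_eq] at hy hz
    obtain ⟨x, hx⟩ : (Q (part f)).Nonempty := by
      rw [← card_pos, hP.card_Q]; exact hP.one_le
    refine Prod.ext (unionEdge_eq_of_mem hH hy.1.1 hz.1.1 (x := x) ?_ ?_) rfl
    · exact hP.subset e (by rw [hy.1.2]; exact hx)
    · exact hP.subset e' (by rw [hz.1.2]; exact hx)

/-- The number of pairs above sets with `r` elements in total is at most `n ^ (1 - 2 r / q) d_t`. -/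
theorem card_edgePairsAbove_le_rpow (hn : 1 ≤ n) (hodd : Odd q) (hH : IsUniformMatching q (H i))
    (hP : IsStrongRegularPartition q t (unionSupp H) part Q)
    (hA : A.card ≤ (q - t + 1) / 2) (hA' : A'.card ≤ (q - t + 1) / 2)
    (hAA' : A.card + A'.card ≤ q - t) :
    ((edgePairsAbove part Q i A A').card : ℝ)
      ≤ (n : ℝ) ^ (1 - 2 * ((A.card + A'.card : ℕ) : ℝ) / q) * maxCodegree (unionSupp H) t := by
  have hn' : (1 : ℝ) ≤ n := by exact_mod_cast hn
  have hq : 0 < q := hodd.pos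
  have hqR : (0 : ℝ) < q := by exact_mod_cast hq
  have ht1 := hP.one_le
  have htq := hP.le
  have hoq := Nat.odd_iff.1 hodd
  rcases A.eq_empty_or_nonempty with rfl | hAne
  · rcases A'.eq_empty_or_nonempty with rfl | hA'ne
    · have := card_edgePairsAbove_le_mul (A := ∅) (A' := ∅) hq hH hP
      simp only [card_empty, add_zero, Nat.cast_zero, mul_zero, zero_div, sub_zero, Real.rpow_one]
      exact_mod_cast this
    · have h1 := card_edgePairsAbove_le_maxCodegree_right (A := ∅) (A' := A') hH hP
      have h2 := hP.good.small A'.card hA'ne.card_pos hA'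
      rw [card_empty, zero_add]
      exact le_trans (by exact_mod_cast h1) h2
  have h1 := card_edgePairsAbove_le_of_nonempty_left (A' := A') hH hP hAne
  have hr : (t : ℝ) - (if Even t then 1 else 0) = ((t - if Even t then 1 else 0 : ℤ) : ℝ) := by
    split_ifs <;> simp
  rcases A'.eq_empty_or_nonempty with rfl | hA'ne
  · rw [card_empty, add_zero] at h1 ⊢
    have h3 : (1 : ℝ) ≤ (n : ℝ) ^ (1 - 2 * (A.card : ℝ) / q) := by
      refine Real.one_le_rpow hn' ?_
      rw [sub_nonneg, div_le_one hqR]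
      have : 2 * A.card ≤ q := by omega
      exact_mod_cast this
    have h4 : ((edgePairsAbove part Q i A ∅).card : ℝ) ≤ maxCodegree (unionSupp H) t := by
      exact_mod_cast h1
    refine h4.trans (le_mul_of_one_le_left (by positivity) h3)
  -- Both sides are nonempty. An index `s ≤ t + |A'|` in the admissible range suffices; the last
  -- condition compares exponents after multiplication by `q`.
  have step : ∀ s : ℕ, t ≤ s → s ≤ (q + t) / 2 → s ≤ t + A'.card →
      2 * (A.card + A'.card) + t + 2 * t ≤ q + 2 * s + (if Even t then 1 else 0) →
      ((edgePairsAbove part Q i A A').card : ℝ)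
      ≤ (n : ℝ) ^ (1 - 2 * ((A.card + A'.card : ℕ) : ℝ) / q) * maxCodegree (unionSupp H) t := by
    intro s hs1 hs2 hs3 hs4
    have h2 := hP.good.large s hs1 hs2
    have h5 : ((edgePairsAbove part Q i A A').card : ℝ) ≤ maxCodegree (unionSupp H) s := by
      exact_mod_cast h1.trans (maxCodegree_antitone _ hs3)
    refine (h5.trans h2).trans (mul_le_mul_of_nonneg_right
      (Real.rpow_le_rpow_of_exponent_le hn' ?_) (by positivity))
    have hs5 : 2 * ((A.card + A'.card : ℕ) : ℝ) + t + 2 * t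
        ≤ q + 2 * s + (if Even t then 1 else 0) := by exact_mod_cast hs4
    have e1 : -(2 / (q : ℝ)) * ((s : ℝ) - t) + 1 / (q : ℝ) * ((t : ℝ) - if Even t then 1 else 0)
        = (-2 * ((s : ℝ) - t) + ((t : ℝ) - if Even t then 1 else 0)) / q := by
      field_simp
    have e2 : 1 - 2 * ((A.card + A'.card : ℕ) : ℝ) / q
        = (q - 2 * ((A.card + A'.card : ℕ) : ℝ)) / q := by
      field_simp
    rw [e1, e2, div_le_div_iff_of_pos_right hqR]
    linarith
  have hpar : Even t ↔ t % 2 = 0 := Nat.even_iff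
  by_cases hs : t + A'.card ≤ (q + t) / 2
  · refine step (t + A'.card) (by omega) hs le_rfl ?_
    split_ifs with h <;> rw [hpar] at h <;> omega
  -- Here `t` is even and `|A'| = ⌈(q-t)/2⌉`, one past the range. Lowering the index by one is
  -- affordable because `|A| + |A'| ≤ q - t` forces `|A| ≤ ⌊(q-t)/2⌋`.
  · refine step (t + A'.card - 1) (by omega) (by omega) (by omega) ?_
    have hcp := hA'ne.card_pos
    split_ifs with h <;> rw [hpar] at h <;> omega
end

/-! ### Balanced subsets of the two copies. -/

section
variable {n : ℕ}

/-- The trace of `B ⊆ [n] × [2]` on the copy of `[n]` numbered `c`. -/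
def copyTrace (B : Finset (Fin n × Fin 2)) (c : Fin 2) : Finset (Fin n) :=
  (B.filter fun x => x.2 = c).image Prod.fst

theorem mem_copyTrace {B : Finset (Fin n × Fin 2)} {c : Fin 2} {x : Fin n} :
    x ∈ copyTrace B c ↔ (x, c) ∈ B := by
  simp [copyTrace]

theorem card_copyTrace (B : Finset (Fin n × Fin 2)) (c : Fin 2) :
    (copyTrace B c).card = (B.filter fun x => x.2 = c).card := by
  refine card_image_of_injOn ?_
  rintro ⟨x, a⟩ hx ⟨y, b⟩ hy h
  simp only [coe_filter, Set.mem_ofPred_eq] at hx hy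
  exact Prod.ext h (hx.2.trans hy.2.symm)

theorem card_copyTrace_add (B : Finset (Fin n × Fin 2)) :
    (copyTrace B 0).card + (copyTrace B 1).card = B.card := by
  rw [card_copyTrace, card_copyTrace, ← card_filter_add_card_filter_not (s := B) (fun x => x.2 = 0)]
  congr 2
  ext x
  simp only [mem_filter, and_congr_right_iff]
  intro _
  have : ∀ c : Fin 2, c = 1 ↔ ¬ c = 0 := by decide
  exact this x.2

theorem copyTrace_mono {B C : Finset (Fin n × Fin 2)} (h : B ⊆ C) (c : Fin 2) :
    copyTrace B c ⊆ copyTrace C c := fun x hx => by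
  rw [mem_copyTrace] at hx ⊢
  exact h hx

/-- The set `A × {1} ∪ A' × {2}`. -/
def twoCopies (A A' : Finset (Fin n)) : Finset (Fin n × Fin 2) :=
  A ×ˢ {0} ∪ A' ×ˢ {1}

theorem copyTrace_twoCopies_zero (A A' : Finset (Fin n)) : copyTrace (twoCopies A A') 0 = A := by
  ext x; simp [mem_copyTrace, twoCopies]

theorem copyTrace_twoCopies_one (A A' : Finset (Fin n)) : copyTrace (twoCopies A A') 1 = A' := by
  ext x; simp [mem_copyTrace, twoCopies]

theorem card_twoCopies (A A' : Finset (Fin n)) : (twoCopies A A').card = A.card + A'.card := by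
  rw [← card_copyTrace_add, copyTrace_twoCopies_zero, copyTrace_twoCopies_one]

/-- The `m`-element subsets of `A × {1} ∪ A' × {2}` with at most `⌈m / 2⌉` elements in either
copy. -/
def balancedSubsets (m : ℕ) (A A' : Finset (Fin n)) : Finset (Finset (Fin n × Fin 2)) :=
  (twoCopies A A').powerset.filter fun B =>
    B.card = m ∧ ∀ c, (copyTrace B c).card ≤ (m + 1) / 2

/-- The trace of `S` on `X ∪ Y` works: its two halves have sizes `⌈m/2⌉` and `⌊m/2⌋` in some order.
-/
theorem exists_balancedSubset_of_kikuchiAdj {m : ℕ} {A A' : Finset (Fin n)}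
    {S T : Finset (Fin n × Fin 2)} (h : KikuchiAdj m A A' S T) :
    ∃ B ∈ balancedSubsets m A A', B ⊆ S := by
  obtain ⟨-, he, ho⟩ := h
  refine ⟨S ∩ twoCopies A A', ?_, inter_subset_left⟩
  have h0 : (copyTrace (S ∩ twoCopies A A') 0).card = (S ∩ A ×ˢ {0}).card := by
    rw [card_copyTrace]
    congr 1
    ext ⟨x, c⟩
    simp only [twoCopies, mem_filter, mem_inter, mem_union, mem_product, mem_singleton]
    constructor
    · rintro ⟨⟨h1, h2⟩, rfl⟩; simpa [h1] using h2
    · rintro ⟨h1, h2, rfl⟩; simp [h1, h2]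
  have h1 : (copyTrace (S ∩ twoCopies A A') 1).card = (S ∩ A' ×ˢ {1}).card := by
    rw [card_copyTrace]
    congr 1
    ext ⟨x, c⟩
    simp only [twoCopies, mem_filter, mem_inter, mem_union, mem_product, mem_singleton]
    constructor
    · rintro ⟨⟨h1, h2⟩, rfl⟩; simpa [h1] using h2
    · rintro ⟨h1, h2, rfl⟩; simp [h1, h2]
  have hs := card_copyTrace_add (S ∩ twoCopies A A')
  simp only [balancedSubsets, mem_filter, mem_powerset, Fin.forall_fin_two]
  refine ⟨inter_subset_right, ?_⟩
  rw [← hs, h0, h1]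
  rcases Nat.even_or_odd m with hm | hm
  · have := he hm
    have := Nat.even_iff.1 hm
    omega
  · have := ho hm
    have := Nat.odd_iff.1 hm
    omega

theorem card_balancedSubsets_le (m : ℕ) (A A' : Finset (Fin n)) :
    (balancedSubsets m A A').card ≤ 2 ^ (A.card + A'.card) := by
  rw [← card_twoCopies, ← card_powerset]
  exact card_filter_le _ _

/-- The row has at most one nonzero entry, since `T = S ⊕ X ⊕ Y`; when it exists, some balanced
subset lies in `S`. -/
theorem sum_kikuchiPairMatrix_le {m ℓ : ℕ} (A A' : Finset (Fin n)) (S : KikuchiVertex n ℓ) :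
    ∑ T, kikuchiPairMatrix m ℓ A A' S T
      ≤ ((balancedSubsets m A A').filter fun B => B ⊆ S.1).card := by
  classical
  simp only [kikuchiPairMatrix]
  rw [← sum_filter, sum_const, nsmul_eq_mul, mul_one, Nat.cast_le]
  rcases (univ.filter fun T : KikuchiVertex n ℓ => KikuchiAdj m A A' S.1 T.1).eq_empty_or_nonempty
    with h0 | ⟨T, hT⟩
  · simp [h0]
  obtain ⟨B, hB, hBS⟩ := exists_balancedSubset_of_kikuchiAdj (mem_filter.1 hT).2
  refine le_trans (card_le_one.2 fun T hT T' hT' => ?_) (card_pos.2 ⟨B, mem_filter.2 ⟨hB, hBS⟩⟩)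
  exact Subtype.ext (symmDiff_right_injective S.1
    ((mem_filter.1 hT).2.1.trans (mem_filter.1 hT').2.1.symm))

end

/-! ### From degrees to monomials. -/

section
variable {n k p : ℕ} {H : Fin k → Finset (Finset (Fin n))}

/-- The triples of a pair of hyperedges in a common part and a balanced `m`-subset of the two
copies of their sides. -/
def kikuchiMonomials (m : ℕ) (part : UnionEdge H → Fin p) (Q : Fin p → Finset (Fin n))
    (i : Fin k) : Finset ((_ : UnionEdge H × UnionEdge H) × Finset (Fin n × Fin 2)) :=
  (edgePairs part i).sigma fun x =>
    balancedSubsets m (unionSupp H x.1 \ Q (part x.1)) (unionSupp H x.2 \ Q (part x.2))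

theorem kikuchiPairMatrix_nonneg (m ℓ : ℕ) (A A' : Finset (Fin n)) (S T : KikuchiVertex n ℓ) :
    0 ≤ kikuchiPairMatrix m ℓ A A' S T := by
  unfold kikuchiPairMatrix
  split_ifs <;> norm_num

theorem kikuchiUnsigned_apply (m ℓ : ℕ) (part : UnionEdge H → Fin p) (Q : Fin p → Finset (Fin n))
    (i j : Fin k) (S T : KikuchiVertex n ℓ) :
    kikuchiUnsigned m ℓ H part Q i j S T
      = ∑ x ∈ edgePairs part i with x.2.1 = j, kikuchiPairMatrix m ℓ
          (unionSupp H x.1 \ Q (part x.1)) (unionSupp H x.2 \ Q (part x.2)) S T := by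
  simp only [kikuchiUnsigned, Matrix.sum_apply]
  simp only [edgePairs, filter_filter, sum_filter]
  rw [Fintype.sum_prod_type, sum_comm]
  refine sum_congr rfl fun e _ => ?_
  rw [sum_eq_single_of_mem (part e) (mem_univ _) (fun θ _ h => if_neg fun h' => h h'.2.symm)]
  by_cases h : e.1 = i
  · simp only [h, and_true, true_and, if_true]
    refine sum_congr rfl fun e' _ => ?_
    by_cases h1 : part e' = part e
    · simp [h1]
    · have h2 : ¬ part e = part e' := fun h => h1 h.symm
      simp [h1, h2]
  · simp [h]

/-- The triangle inequality removes the signs, and nonnegativity allows `R` to be enlarged to all of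
`[k]`, so the bound does not depend on the partition. -/
theorem kikuchiDegree_le (m ℓ : ℕ) (part : UnionEdge H → Fin p) (Q : Fin p → Finset (Fin n))
    (R : Finset (Fin k)) (i : Fin k) (S : KikuchiVertex n ℓ) :
    kikuchiDegree m ℓ H part Q R i S
      ≤ ((kikuchiMonomials m part Q i).filter fun x => x.2 ⊆ S.1).card := by
  refine ciSup_le fun b => ?_
  have hnn : ∀ j T, 0 ≤ kikuchiUnsigned m ℓ H part Q i j S T := fun j T => by
    rw [kikuchiUnsigned_apply]
    exact sum_nonneg fun _ _ => kikuchiPairMatrix_nonneg _ _ _ _ _ _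
  calc ∑ T, |kikuchiSigned m ℓ H part Q R b i S T|
      ≤ ∑ T, ∑ j, kikuchiUnsigned m ℓ H part Q i j S T := by
        refine sum_le_sum fun T _ => ?_
        rw [kikuchiSigned, Matrix.sum_apply]
        refine (abs_sum_le_sum_abs _ _).trans ((sum_le_sum fun j _ => ?_).trans
          (sum_le_univ_sum_of_nonneg fun j => hnn j T))
        rw [Matrix.smul_apply, smul_eq_mul, abs_mul, abs_of_nonneg (hnn j T)]
        rcases Int.units_eq_one_or (b j) with h | h <;> simp [h]
    _ = ∑ x ∈ edgePairs part i, ∑ T, kikuchiPairMatrix m ℓ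
          (unionSupp H x.1 \ Q (part x.1)) (unionSupp H x.2 \ Q (part x.2)) S T := by
        rw [sum_comm (s := edgePairs part i)]
        refine sum_congr rfl fun T _ => ?_
        simp only [kikuchiUnsigned_apply]
        exact sum_fiberwise _ _ _
    _ ≤ ∑ x ∈ edgePairs part i, (((balancedSubsets m (unionSupp H x.1 \ Q (part x.1))
          (unionSupp H x.2 \ Q (part x.2))).filter fun B => B ⊆ S.1).card : ℝ) :=
        sum_le_sum fun x _ => sum_kikuchiPairMatrix_le _ _ S
    _ = _ := by
        rw [← Nat.cast_sum, ← card_sigma]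
        congr 2
        ext x
        simp only [kikuchiMonomials, mem_sigma, mem_filter]
        tauto

theorem card_kikuchiMonomials_above_le {q t : ℕ} {part : UnionEdge H → Fin p}
    {Q : Fin p → Finset (Fin n)} {i : Fin k} (hn : 1 ≤ n) (hodd : Odd q)
    (hH : IsUniformMatching q (H i)) (hP : IsStrongRegularPartition q t (unionSupp H) part Q)
    (B : Finset (Fin n × Fin 2)) :
    (((kikuchiMonomials (q - t) part Q i).filter fun x => B ⊆ x.2).card : ℝ)
      ≤ 4 ^ (q - t) * ((n : ℝ) ^ (1 - 2 * (B.card : ℝ) / q) * maxCodegree (unionSupp H) t) := by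
  -- A monomial above `B` supplies the size bounds on the traces of `B` that the pair count
  -- requires.
  rcases ((kikuchiMonomials (q - t) part Q i).filter fun x => B ⊆ x.2).eq_empty_or_nonempty with
    h0 | ⟨x, hx⟩
  · rw [h0, card_empty, Nat.cast_zero]
    positivity
  have hside : ∀ e : UnionEdge H, (unionSupp H e \ Q (part e)).card = q - t := fun e => by
    rw [card_sdiff_of_subset (hP.subset e), hP.uniform, hP.card_Q]
  have hcount : ((kikuchiMonomials (q - t) part Q i).filter fun x => B ⊆ x.2).card
      ≤ 4 ^ (q - t) * (edgePairsAbove part Q i (copyTrace B 0) (copyTrace B 1)).card := by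
    refine le_trans (card_le_card (t := (edgePairsAbove part Q i (copyTrace B 0)
      (copyTrace B 1)).sigma fun x => balancedSubsets (q - t) (unionSupp H x.1 \ Q (part x.1))
        (unionSupp H x.2 \ Q (part x.2))) ?_) ?_
    · intro y hy
      simp only [kikuchiMonomials, mem_filter, mem_sigma, edgePairsAbove] at hy ⊢
      refine ⟨⟨hy.1.1, ?_⟩, hy.1.2⟩
      have h1 := hy.2.trans (mem_powerset.1 (mem_filter.1 hy.1.2).1)
      have h2 := copyTrace_mono h1 0
      have h3 := copyTrace_mono h1 1
      rw [copyTrace_twoCopies_zero] at h2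
      rw [copyTrace_twoCopies_one] at h3
      exact ⟨h2, h3⟩
    · rw [card_sigma, mul_comm]
      refine sum_le_card_nsmul _ _ _ fun y _ => (card_balancedSubsets_le _ _ _).trans ?_
      rw [hside, hside, ← two_mul, pow_mul]
      norm_num
  simp only [kikuchiMonomials, mem_filter, mem_sigma] at hx
  obtain ⟨⟨-, hx1⟩, hBx⟩ := hx
  obtain ⟨-, hcard, htr⟩ := mem_filter.1 hx1
  have hpairs := card_edgePairsAbove_le_rpow (A := copyTrace B 0) (A' := copyTrace B 1) hn hodd hH hP
    ((card_le_card (copyTrace_mono hBx 0)).trans (htr 0))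
    ((card_le_card (copyTrace_mono hBx 1)).trans (htr 1))
    (by rw [card_copyTrace_add, ← hcard]; exact card_le_card hBx)
  rw [card_copyTrace_add] at hpairs
  calc (((kikuchiMonomials (q - t) part Q i).filter fun x => B ⊆ x.2).card : ℝ)
      ≤ 4 ^ (q - t) * ((edgePairsAbove part Q i (copyTrace B 0) (copyTrace B 1)).card : ℝ) := by
        exact_mod_cast hcount
    _ ≤ _ := mul_le_mul_of_nonneg_left hpairs (by positivity)

end

/-! ### Moment estimate and tail bound. -/

/-- In use, `u = n^(-2/q)`, `v = ℓ/n` and `L = log n`. Then `smu ≤ 4mv`, so the `r`-th term is at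
most `c v^m (4m)^r / r!`. -/
theorem sum_choose_mul_le_exp {m s : ℕ} {u v p c L : ℝ} (hu : 0 ≤ u) (hp : 0 ≤ p)
    (hpv : p ≤ v) (hc : 0 ≤ c) (hsL : (s : ℝ) ≤ 2 * L) (huv : u * L ≤ 2 * v) :
    ∑ r ∈ range (m + 1), ((s * m).choose r : ℝ) * (c * u ^ r * p ^ (m - r))
      ≤ c * v ^ m * Real.exp (4 * m) := by
  have hv : 0 ≤ v := hp.trans hpv
  have h1 : ∀ r ∈ range (m + 1), ((s * m).choose r : ℝ) * (c * u ^ r * p ^ (m - r))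
      ≤ c * v ^ m * ((4 * m : ℝ) ^ r / r.factorial) := by
    intro r hr
    have hrm : r ≤ m := by rw [mem_range] at hr; omega
    have h2 : ((s * m).choose r : ℝ) ≤ ((s * m : ℕ) : ℝ) ^ r / r.factorial :=
      Nat.choose_le_pow_div r (s * m)
    have h3 : ((s * m : ℕ) : ℝ) * u ≤ 4 * m * v := by
      push_cast
      calc (s : ℝ) * m * u ≤ 2 * L * m * u := by gcongr
        _ = 2 * m * (u * L) := by ring
        _ ≤ 2 * m * (2 * v) := by gcongr
        _ = _ := by ring
    calc ((s * m).choose r : ℝ) * (c * u ^ r * p ^ (m - r))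
        ≤ (((s * m : ℕ) : ℝ) ^ r / r.factorial) * (c * u ^ r * v ^ (m - r)) := by gcongr
      _ = (((s * m : ℕ) : ℝ) * u) ^ r / r.factorial * (c * v ^ (m - r)) := by
          rw [mul_pow]; ring
      _ ≤ (4 * m * v) ^ r / r.factorial * (c * v ^ (m - r)) := by gcongr
      _ = (4 * m : ℝ) ^ r / r.factorial * (c * (v ^ r * v ^ (m - r))) := by
          rw [mul_pow (4 * m : ℝ)]; ring
      _ = _ := by rw [← pow_add, Nat.add_sub_cancel' hrm]; ring
  refine (sum_le_sum h1).trans ?_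
  rw [← mul_sum]
  exact mul_le_mul_of_nonneg_left (Real.sum_le_exp_of_nonneg (by positivity) _) (by positivity)

/-- Markov's inequality for the `s`-th moment under the uniform distribution. -/
theorem card_filter_not_le_mul_pow_le {V : Type*} [Fintype V] (f : V → ℝ)
    (hf : ∀ S, 0 ≤ f S) (lam B : ℝ) (hl : 0 ≤ lam) (s : ℕ)
    (hB : ∑ S, f S ^ s ≤ Fintype.card V * B ^ s)
    [DecidablePred fun S => ¬ f S ≤ lam] :
    ((univ.filter fun S => ¬ f S ≤ lam).card : ℝ) * lam ^ s ≤ Fintype.card V * B ^ s := by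
  refine le_trans ?_ hB
  rw [← nsmul_eq_mul]
  refine (card_nsmul_le_sum _ (fun S => f S ^ s) _ fun S hS => ?_).trans
    (sum_le_univ_sum_of_nonneg fun S => pow_nonneg (hf S) s)
  exact pow_le_pow_left₀ hl (not_le.1 (mem_filter.1 hS).2).le s

section
variable {n k p q t ℓ : ℕ} {H : Fin k → Finset (Finset (Fin n))} {part : UnionEdge H → Fin p}
  {Q : Fin p → Finset (Fin n)} {i : Fin k}

/-- The ground set `[n] × [2]` has density `ℓ/(2n)`, which is relaxed to `ℓ/n`. -/
theorem sum_pow_card_kikuchiMonomials_le (hn : 1 ≤ n) (hodd : Odd q)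
    (hH : IsUniformMatching q (H i)) (hP : IsStrongRegularPartition q t (unionSupp H) part Q)
    {L : ℝ} (s : ℕ) (hs : (s : ℝ) ≤ 2 * L) (hL : (n : ℝ) ^ (1 - 2 / (q : ℝ)) * L ≤ 2 * ℓ) :
    ∑ S : KikuchiVertex n ℓ,
        (((kikuchiMonomials (q - t) part Q i).filter fun x => x.2 ⊆ S.1).card : ℝ) ^ s
      ≤ Fintype.card (KikuchiVertex n ℓ) * (4 ^ (q - t) * (n * maxCodegree (unionSupp H) t) *
          ((ℓ : ℝ) / n) ^ (q - t) * Real.exp (4 * (q - t : ℕ))) ^ s := by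
  have hn0 : (0 : ℝ) < n := by exact_mod_cast hn
  have hcardα : (Fintype.card (Fin n × Fin 2) : ℝ) = n * 2 := by simp
  set m := q - t with hm
  set c : ℝ := 4 ^ m * (n * maxCodegree (unionSupp H) t) with hc
  set u : ℝ := (n : ℝ) ^ (-(2 / (q : ℝ))) with hu
  have hu0 : 0 ≤ u := by positivity
  set P : ℝ := (ℓ : ℝ) / Fintype.card (Fin n × Fin 2) with hPdef
  have hP0 : 0 ≤ P := by positivity
  have hpow : ∀ r : ℕ, (n : ℝ) ^ (1 - 2 * (r : ℝ) / q) = n * u ^ r := fun r => by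
    rw [hu, ← Real.rpow_natCast, ← Real.rpow_mul hn0.le, sub_eq_add_neg, Real.rpow_add hn0,
      Real.rpow_one]
    congr 2
    ring
  have hmom := sum_pow_card_filter_subset_le (kikuchiMonomials m part Q i) (fun x => x.2) m ℓ
    (s * m) (fun x hx => (mem_filter.1 (mem_sigma.1 hx).2).2.1)
    (fun r => c * u ^ r * P ^ (m - r)) (fun r => by positivity)
    (fun A _ => by
      refine mul_le_mul_of_nonneg_right
        ((card_kikuchiMonomials_above_le hn hodd hH hP A).trans_eq ?_) (by positivity)
      rw [hpow, hc]
      ring) s ∅ (by simp)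
  simp only [empty_subset, filter_true, card_empty, pow_zero, mul_one] at hmom
  refine hmom.trans ?_
  have hsum := sum_choose_mul_le_exp (m := m) (s := s) (u := u) (v := (ℓ : ℝ) / n) (p := P)
    (c := c) (L := L) hu0 hP0
    (by
      rw [hPdef, hcardα]
      exact div_le_div_of_nonneg_left (by positivity) hn0 (by linarith))
    (by positivity) hs
    (by
      have h1 := hpow 1
      rw [Nat.cast_one, mul_one, pow_one] at h1
      rw [h1] at hL
      rw [← mul_div_assoc, le_div_iff₀ hn0]
      linarith)
  refine mul_le_mul_of_nonneg_left (pow_le_pow_left₀ ?_ hsum s) (by positivity)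
  exact sum_nonneg fun r _ => by positivity

theorem card_kikuchiMonomials_le (hn : 1 ≤ n) (hodd : Odd q)
    (hH : IsUniformMatching q (H i)) (hP : IsStrongRegularPartition q t (unionSupp H) part Q)
    (S : KikuchiVertex n ℓ) :
    (((kikuchiMonomials (q - t) part Q i).filter fun x => x.2 ⊆ S.1).card : ℝ)
      ≤ 4 ^ (q - t) * (n * maxCodegree (unionSupp H) t) := by
  have h := card_kikuchiMonomials_above_le hn hodd hH hP ∅
  simp only [empty_subset, filter_true, card_empty, Nat.cast_zero, mul_zero, zero_div, sub_zero,
    Real.rpow_one] at h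
  refine le_trans ?_ h
  exact_mod_cast card_filter_le _ _

/-- In the constant, `e^4` comes from the exponential series and `e^100` pays for the tail. The
moment bound needs only `4` in front; `32 = 4 · 8` serves the case `n ≤ 8`. -/
theorem four_pow_mul_exp_le (m : ℕ) (hm : m ≤ q) :
    (4 : ℝ) ^ m * Real.exp (4 * m) * Real.exp (100 * q) ≤ (32 * Real.exp 104) ^ q := by
  have h1 : (4 : ℝ) ^ m ≤ 32 ^ q :=
    (pow_le_pow_right₀ (by norm_num) hm).trans (pow_le_pow_left₀ (by norm_num) (by norm_num) q)
  have h2 : Real.exp (4 * m) ≤ Real.exp (4 * q) := by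
    rw [Real.exp_le_exp]
    have : (m : ℝ) ≤ q := by exact_mod_cast hm
    linarith
  have h3 : Real.exp 104 ^ q = Real.exp (4 * q) * Real.exp (100 * q) := by
    rw [← Real.exp_nat_mul, ← Real.exp_add]
    congr 1
    ring
  rw [mul_pow, h3, ← mul_assoc]
  gcongr

/-- The degree bound holds for every vertex if there are few ground elements. -/
theorem card_kikuchiMonomials_le_of_small (hn : 1 ≤ n) (hn8 : n ≤ 8) (hodd : Odd q)
    (hH : IsUniformMatching q (H i)) (hP : IsStrongRegularPartition q t (unionSupp H) part Q)
    (S : KikuchiVertex n ℓ) :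
    (((kikuchiMonomials (q - t) part Q i).filter fun x => x.2 ⊆ S.1).card : ℝ)
      ≤ ((ℓ : ℝ) / n) ^ (q - t) * n * maxCodegree (unionSupp H) t *
        (32 * Real.exp 104) ^ q := by
  have hn0 : (0 : ℝ) < n := by exact_mod_cast hn
  rcases ((kikuchiMonomials (q - t) part Q i).filter fun x => x.2 ⊆ S.1).eq_empty_or_nonempty
    with h0 | ⟨x, hx⟩
  · rw [h0, card_empty, Nat.cast_zero]
    positivity
  -- If anything is counted and `q > t`, then `ℓ ≥ 1`, so `ℓ/n ≥ 1/8`.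
  have hmℓ : q - t ≤ ℓ := by
    obtain ⟨hx1, hx2⟩ := mem_filter.1 hx
    rw [← (mem_filter.1 (mem_sigma.1 hx1).2).2.1, ← S.2]
    exact card_le_card hx2
  have h1 : (1 / 8 : ℝ) ^ (q - t) ≤ ((ℓ : ℝ) / n) ^ (q - t) := by
    rcases Nat.eq_zero_or_pos (q - t) with h | h
    · rw [h, pow_zero, pow_zero]
    · refine pow_le_pow_left₀ (by norm_num) ?_ _
      have h2 : (1 : ℝ) ≤ ℓ := by exact_mod_cast h.trans_le hmℓ
      have h3 : (n : ℝ) ≤ 8 := by exact_mod_cast hn8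
      rw [div_le_div_iff₀ (by norm_num) hn0]
      linarith
  have h2 : (4 : ℝ) ^ (q - t) ≤ (1 / 8 : ℝ) ^ (q - t) * (32 * Real.exp 104) ^ q := by
    have h3 : (32 : ℝ) ≤ 32 * Real.exp 104 := by
      have := Real.one_le_exp (x := 104) (by norm_num)
      linarith
    calc (4 : ℝ) ^ (q - t) = (1 / 8 : ℝ) ^ (q - t) * 32 ^ (q - t) := by
          rw [← mul_pow]; norm_num
      _ ≤ (1 / 8 : ℝ) ^ (q - t) * 32 ^ q := by gcongr <;> [norm_num; omega]
      _ ≤ _ := by gcongr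
  refine (card_kikuchiMonomials_le hn hodd hH hP S).trans ?_
  calc (4 : ℝ) ^ (q - t) * (n * maxCodegree (unionSupp H) t)
      ≤ (((ℓ : ℝ) / n) ^ (q - t) * (32 * Real.exp 104) ^ q) *
        (n * maxCodegree (unionSupp H) t) := by
        refine mul_le_mul_of_nonneg_right (h2.trans ?_) (by positivity)
        gcongr
    _ = _ := by ring

/-- With the product at least `2`, rounding it to `ℓ` loses at most a factor `2`. -/
theorem two_le_rpow_mul_log (hq : 3 ≤ q) (hn : 8 ≤ n) :
    1 ≤ Real.log n ∧ 2 ≤ (n : ℝ) ^ (1 - 2 / (q : ℝ)) * Real.log n := by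
  have hn' : (8 : ℝ) ≤ n := by exact_mod_cast hn
  have hlog : 1 ≤ Real.log n := by
    rw [Real.le_log_iff_exp_le (by linarith)]
    linarith [Real.exp_one_lt_d9]
  have hq' : (3 : ℝ) ≤ q := by exact_mod_cast hq
  have h1 : (2 : ℝ) ≤ (n : ℝ) ^ (1 - 2 / (q : ℝ)) := by
    calc (2 : ℝ) = (8 : ℝ) ^ (1 / 3 : ℝ) := by
          rw [show (8 : ℝ) = 2 ^ (3 : ℝ) by norm_num, ← Real.rpow_mul (by norm_num)]
          norm_num
      _ ≤ (n : ℝ) ^ (1 / 3 : ℝ) := Real.rpow_le_rpow (by norm_num) hn' (by norm_num)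
      _ ≤ _ := by
          refine Real.rpow_le_rpow_of_exponent_le (by linarith) ?_
          have : 2 / (q : ℝ) ≤ 2 / 3 := div_le_div_of_nonneg_left (by norm_num) (by norm_num) hq'
          linarith
  exact ⟨hlog, by nlinarith⟩

open Classical in
/-- All but few vertices contain few balanced sets. -/
theorem card_filter_kikuchiMonomials_not_le (hq : 3 ≤ q) (hodd : Odd q)
    (hH : IsUniformMatching q (H i)) (hP : IsStrongRegularPartition q t (unionSupp H) part Q)
    (hℓ : |(ℓ : ℝ) - (n : ℝ) ^ (1 - 2 / (q : ℝ)) * Real.log n| < 1) :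
    ((univ.filter fun S : KikuchiVertex n ℓ =>
      ¬ (((kikuchiMonomials (q - t) part Q i).filter fun x => x.2 ⊆ S.1).card : ℝ)
        ≤ ((ℓ : ℝ) / n) ^ (q - t) * n * maxCodegree (unionSupp H) t *
          (32 * Real.exp 104) ^ q).card : ℝ)
      ≤ (n : ℝ) ^ (-(100 * (q : ℝ))) * Fintype.card (KikuchiVertex n ℓ) := by
  set f : KikuchiVertex n ℓ → ℝ := fun S =>
    (((kikuchiMonomials (q - t) part Q i).filter fun x => x.2 ⊆ S.1).card : ℝ) with hf
  set d := maxCodegree (unionSupp H) t with hd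
  set lam : ℝ := ((ℓ : ℝ) / n) ^ (q - t) * n * d * (32 * Real.exp 104) ^ q with hlam
  have trivial_case : (∀ S, f S ≤ lam) →
      ((univ.filter fun S => ¬ f S ≤ lam).card : ℝ)
        ≤ (n : ℝ) ^ (-(100 * (q : ℝ))) * Fintype.card (KikuchiVertex n ℓ) := fun h => by
    rw [filter_false_of_mem (fun S _ => not_not.2 (h S)), card_empty, Nat.cast_zero]
    positivity
  have hlam0 : 0 ≤ lam := by positivity
  rcases Nat.eq_zero_or_pos n with hn0 | hn0
  · refine trivial_case fun S => ?_
    have : edgePairs part i = ∅ := by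
      refine eq_empty_of_forall_notMem fun x _ => ?_
      have h1 := hP.uniform x.1
      have h2 := card_le_univ (unionSupp H x.1)
      rw [Fintype.card_fin] at h2
      omega
    have h0 : kikuchiMonomials (q - t) part Q i = ∅ := by
      rw [kikuchiMonomials, this]
      rfl
    simp only [hf, h0, filter_empty, card_empty, Nat.cast_zero]
    exact hlam0
  rcases Nat.lt_or_ge n 8 with hn8 | hn8
  · exact trivial_case fun S => card_kikuchiMonomials_le_of_small hn0 hn8.le hodd hH hP S
  -- If `d_t = 0` the threshold vanishes and could not be cancelled after Markov's inequality; but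
  -- then there are no monomials.
  rcases Nat.eq_zero_or_pos d with hd0 | hd0
  · refine trivial_case fun S => (card_kikuchiMonomials_le hn0 hodd hH hP S).trans ?_
    rw [← hd, hd0, Nat.cast_zero, mul_zero, mul_zero]
    exact hlam0
  obtain ⟨hlog, hbig⟩ := two_le_rpow_mul_log hq hn8
  have hℓ2 : (n : ℝ) ^ (1 - 2 / (q : ℝ)) * Real.log n ≤ 2 * ℓ := by
    have := (abs_lt.1 hℓ).1
    linarith
  have hℓ0 : (0 : ℝ) < ℓ := by linarith
  have hnR : (0 : ℝ) < n := by exact_mod_cast hn0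
  have hdR : (0 : ℝ) < d := by exact_mod_cast hd0
  have hlampos : 0 < lam := by positivity
  -- Large enough that `e^(-100qs) ≤ n^(-100q)`, small enough that `s ≤ 2 log n`.
  set s := ⌈Real.log n⌉₊ with hs
  have hs1 : Real.log n ≤ s := Nat.le_ceil _
  have hs2 : (s : ℝ) ≤ 2 * Real.log n := by
    have := Nat.ceil_lt_add_one (a := Real.log n) (by linarith)
    linarith
  set B : ℝ := 4 ^ (q - t) * (n * d) * ((ℓ : ℝ) / n) ^ (q - t) * Real.exp (4 * (q - t : ℕ)) with hB
  have hB0 : 0 ≤ B := by positivity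
  have hmark := card_filter_not_le_mul_pow_le f (fun S => by positivity) lam B hlam0 s
    (sum_pow_card_kikuchiMonomials_le hn0 hodd hH hP s hs2 hℓ2)
  have hBlam : B * Real.exp (100 * q) ≤ lam := by
    calc B * Real.exp (100 * q)
        = ((ℓ : ℝ) / n) ^ (q - t) * n * d *
          (4 ^ (q - t) * Real.exp (4 * (q - t : ℕ)) * Real.exp (100 * q)) := by rw [hB]; ring
      _ ≤ lam := mul_le_mul_of_nonneg_left (four_pow_mul_exp_le _ (by omega)) (by positivity)
  have hexp : B ^ s ≤ (n : ℝ) ^ (-(100 * (q : ℝ))) * lam ^ s := by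
    have h1 : B ≤ lam * Real.exp (-(100 * q)) := by
      rw [Real.exp_neg, ← div_eq_mul_inv, le_div_iff₀ (Real.exp_pos _)]
      exact hBlam
    calc B ^ s ≤ (lam * Real.exp (-(100 * q))) ^ s := pow_le_pow_left₀ hB0 h1 s
      _ = Real.exp (-(100 * q)) ^ s * lam ^ s := by rw [mul_pow, mul_comm]
      _ ≤ _ := by
          refine mul_le_mul_of_nonneg_right ?_ (by positivity)
          rw [← Real.exp_nat_mul, Real.rpow_def_of_pos hnR, Real.exp_le_exp]
          have : (0 : ℝ) ≤ 100 * q := by positivity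
          nlinarith
  refine le_of_mul_le_mul_right (hmark.trans ?_) (pow_pos hlampos s)
  calc (Fintype.card (KikuchiVertex n ℓ) : ℝ) * B ^ s
      ≤ Fintype.card (KikuchiVertex n ℓ) * ((n : ℝ) ^ (-(100 * (q : ℝ))) * lam ^ s) := by gcongr
    _ = _ := by ring
end

open Classical in
theorem lemma4p10 :
    ∃ W : ℝ, 1 ≤ W ∧
      ∀ (q t n k ℓ p : ℕ) (H : Fin k → Finset (Finset (Fin n)))
        (part : UnionEdge H → Fin p) (Q : Fin p → Finset (Fin n)),
        3 ≤ q → Odd q →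
        (∀ i, IsUniformMatching q (H i)) →
        IsStrongRegularPartition q t (unionSupp H) part Q →
        -- `ℓ` is `n ^ (1 - 2 / q) * log n`, rounded up or down to an integer
        |(ℓ : ℝ) - (n : ℝ) ^ (1 - 2 / (q : ℝ)) * Real.log n| < 1 →
        maxCodegree (unionSupp H) 1 ≤ k →
        ℓ ≤ maxCodegree (unionSupp H) 1 →
        (2 * t < q →
          (maxCodegree (unionSupp H) 1 : ℝ) * (n : ℝ) ^ (-(2 * ((t : ℝ) - 1) / q))
            ≤ maxCodegree (unionSupp H) t) ∧
        (q < 2 * t →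
          (maxCodegree (unionSupp H) 1 : ℝ) * (n : ℝ) ^ (-1 + 2 / (q : ℝ))
            ≤ maxCodegree (unionSupp H) t) ∧
        ∀ L R : Finset (Fin k), Disjoint L R → L ∪ R = Finset.univ → ∀ i ∈ L,
          ((Finset.univ.filter fun S : KikuchiVertex n ℓ =>
              ¬ kikuchiDegree (q - t) ℓ H part Q R i S
                ≤ ((ℓ : ℝ) / n) ^ (q - t) * n * maxCodegree (unionSupp H) t * W ^ q).card : ℝ)
            ≤ (n : ℝ) ^ (-(100 * (q : ℝ))) * Fintype.card (KikuchiVertex n ℓ) := by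
  refine ⟨32 * Real.exp 104, ?_, ?_⟩
  · have := Real.one_le_exp (x := 104) (by norm_num)
    linarith
  intro q t n k ℓ p H part Q hq hodd hH hP hℓ _ _
  refine ⟨fun h => ?_, hP.good.lower_right, fun L R _ _ i _ => ?_⟩
  · have := hP.good.lower_left h
    rwa [show -(2 / (q : ℝ)) * ((t : ℝ) - 1) = -(2 * ((t : ℝ) - 1) / q) by ring] at this
  · refine le_trans (Nat.cast_le.2 (card_le_card fun S hS => ?_))
      (card_filter_kikuchiMonomials_not_le hq hodd (hH i) hP hℓ)
    rw [mem_filter] at hS ⊢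
    exact ⟨mem_univ _, fun h => hS.2 ((kikuchiDegree_le _ _ _ _ _ _ _).trans h)⟩
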